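/- Let $d > 1$ be a square-free integer. For an integer $n \ge 2$ consider the equation $$x_1^2 + \dots + x_n^2 = d\,x_{n+1}^2, \qquad (\ast)$$ and call $(x_1,\dots,x_n,x_{n+1}) \in \mathbb Z^{n+1}$ a nontrivial integral solution if it satisfies $(\ast)$ and is not $(0,\dots,0)$. (1) For $n = 2$, $(\ast)$ has a nontrivial integral solution if and only if $d$ has no prime divisor congruent to $3$ modulo $4$. (2) For $n = 3$, $(\ast)$ has a nontrivial integral solution if and only if $d \not\equiv 7 \pmod 8$. (3) For every $n \ge 4$, $(\ast)$ has a nontrivial integral solution, whatever the value of $d$. Moreover, if $n \ge 5$, then for every permutation $\sigma$ of $\{1,\dots,n\}$ and every $(a_1,\dots,a_{n-4}) \in \mathbb Z^{n-4}$, $(\ast)$ has a nontrivial integral solution $(x_1,\dots,x_n,x_{n+1})$ such that $(x_{\sigma(1)},\dots,x_{\sigma(n-4)}) = (a_1,\dots,a_{n-4})$. -/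

import Mathlib

/-- `x = (x₁, …, xₙ, xₙ₊₁)` is an integral solution of `x₁² + ⋯ + xₙ² = d xₙ₊₁²`.
The coordinates `x₁, …, xₙ` are `x i.castSucc` for `i : Fin n`, and `xₙ₊₁` is `x (Fin.last n)`. -/
def IsPellLikeSolution (n : ℕ) (d : ℤ) (x : Fin (n + 1) → ℤ) : Prop :=
  ∑ i : Fin n, x i.castSucc ^ 2 = d * x (Fin.last n) ^ 2

/-! For `n = 2` this is Fermat's two-square criterion. For `n = 3`, the class 7 modulo 8 is excluded
by 2-adic descent. Otherwise Dirichlet and quadratic reciprocity supply `N = u² + v²` with `N ≡ -1`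
mod `d` and `d` a square mod `N`. Legendre's theorem then gives `d t² = y² + N z² = y² + (zu)² +
(zv)²`. For `n ≥ 4`, Lagrange's four squares absorb whatever the prescribed coordinates leave over.
-/

/-- Legendre's theorem for `d x² = y² + N z²` with `d`, `N` coprime and neither a square. -/
theorem exists_mul_sq_eq_sq_add_mul_sq {d N : ℕ} (hd : ¬ IsSquare d) (hN : ¬ IsSquare N)
    (hco : d.Coprime N) {a b : ℤ} (ha : (N : ℤ) ∣ a ^ 2 - d) (hb : (d : ℤ) ∣ b ^ 2 + N) :
    ∃ x y z : ℤ, x ≠ 0 ∧ d * x ^ 2 = y ^ 2 + N * z ^ 2 := by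
  have hd0 : 0 < d := Nat.pos_of_ne_zero fun h => hd (h ▸ IsSquare.zero)
  have hN0 : 0 < N := Nat.pos_of_ne_zero fun h => hN (h ▸ IsSquare.zero)
  have : NeZero d := ⟨hd0.ne'⟩
  have : NeZero N := ⟨hN0.ne'⟩
  -- Thue-style pigeonhole: the box has more than `N * d` points, so two of them agree in `y - a x`
  -- mod `N` and `y - b z` mod `d`.
  let S : Finset (ℕ × ℕ × ℕ) := Finset.range (N.sqrt + 1) ×ˢ
    Finset.range ((d * N).sqrt + 1) ×ˢ Finset.range (d.sqrt + 1)
  let f : ℕ × ℕ × ℕ → ZMod N × ZMod d := fun t =>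
    ((((t.2.1 : ℤ) - a * t.1 : ℤ) : ZMod N), (((t.2.1 : ℤ) - b * t.2.2 : ℤ) : ZMod d))
  have hcard : (Finset.univ : Finset (ZMod N × ZMod d)).card < S.card := by
    simp only [S, Finset.card_product, Finset.card_range, Finset.card_univ, Fintype.card_prod,
      ZMod.card]
    have h1 := Nat.succ_le_succ_sqrt' N
    have h2 := Nat.succ_le_succ_sqrt' (d * N)
    have h3 := Nat.succ_le_succ_sqrt' d
    have h : (N * d) ^ 2 < ((N.sqrt + 1) * (((d * N).sqrt + 1) * (d.sqrt + 1))) ^ 2 := by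
      calc (N * d) ^ 2 = N * (d * N * d) := by ring
        _ < (N.sqrt + 1) ^ 2 * (((d * N).sqrt + 1) ^ 2 * (d.sqrt + 1) ^ 2) := by
          gcongr <;> omega
        _ = _ := by ring
    exact lt_of_pow_lt_pow_left₀ 2 (Nat.zero_le _) h
  obtain ⟨⟨x₁, y₁, z₁⟩, h₁, ⟨x₂, y₂, z₂⟩, h₂, hne, heq⟩ :=
    Finset.exists_ne_map_eq_of_card_lt_of_maps_to hcard
      (f := f) (fun _ _ => Finset.mem_coe.2 (Finset.mem_univ _))
  simp only [S, Finset.mem_product, Finset.mem_range, Nat.lt_succ_iff] at h₁ h₂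
  obtain ⟨hx₁, hy₁, hz₁⟩ := h₁
  obtain ⟨hx₂, hy₂, hz₂⟩ := h₂
  simp only [f, Prod.mk.injEq] at heq
  obtain ⟨e₁, e₂⟩ := heq
  rw [ZMod.intCast_eq_intCast_iff_dvd_sub] at e₁ e₂
  have key : ∀ {M u v : ℕ}, u ≤ M.sqrt → v ≤ M.sqrt → ((u : ℤ) - v) ^ 2 ≤ M := by
    intro M u v hu hv
    have hM : ((M.sqrt : ℕ) : ℤ) ^ 2 ≤ M := by exact_mod_cast Nat.sqrt_le' M
    refine le_trans (sq_le_sq' ?_ ?_) hM <;> omega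
  have hx := key hx₂ hx₁
  have hy := key hy₂ hy₁
  have hz := key hz₂ hz₁
  have hne' : ¬ ((x₂ : ℤ) - x₁ = 0 ∧ (y₂ : ℤ) - y₁ = 0 ∧ (z₂ : ℤ) - z₁ = 0) := by
    rintro ⟨hx, hy, hz⟩
    apply hne
    simp only [Prod.mk.injEq]
    omega
  have e₁' : (N : ℤ) ∣ ((y₂ : ℤ) - y₁) - a * (x₂ - x₁) := by convert e₁ using 1; ring
  have e₂' : (d : ℤ) ∣ ((y₂ : ℤ) - y₁) - b * (z₂ - z₁) := by convert e₂ using 1; ring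
  generalize (x₂ : ℤ) - x₁ = x at *
  generalize (y₂ : ℤ) - y₁ = y at *
  generalize (z₂ : ℤ) - z₁ = z at *
  have dN : (N : ℤ) ∣ y ^ 2 + N * z ^ 2 - d * x ^ 2 := by
    have : y ^ 2 + N * z ^ 2 - d * x ^ 2 =
      (y - a * x) * (y + a * x) + (a ^ 2 - d) * x ^ 2 + N * z ^ 2 := by ring
    rw [this]
    exact dvd_add (dvd_add (e₁'.mul_right _) (ha.mul_right _)) (dvd_mul_right _ _)
  have dd : (d : ℤ) ∣ y ^ 2 + N * z ^ 2 - d * x ^ 2 := by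
    have : y ^ 2 + N * z ^ 2 - d * x ^ 2 =
      (y - b * z) * (y + b * z) + (b ^ 2 + N) * z ^ 2 - d * x ^ 2 := by ring
    rw [this]
    exact dvd_sub (dvd_add (e₂'.mul_right _) (hb.mul_right _)) (dvd_mul_right _ _)
  obtain ⟨k, hk⟩ := (Nat.isCoprime_iff_coprime.2 hco).mul_dvd dd dN
  have hdZ : (0 : ℤ) < d := by exact_mod_cast hd0
  have hNZ : (0 : ℤ) < N := by exact_mod_cast hN0
  -- Non-squareness makes `x² < N` and `z² < d` strict, so `y² + N z² - d x² = d N k` lies strictly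
  -- between `-d N` and `2 d N`.
  have notsq : ∀ {M : ℕ}, ¬ IsSquare M → ∀ w : ℤ, w ^ 2 ≤ M → w ^ 2 < M := by
    intro M hM w hw
    refine lt_of_le_of_ne hw fun h => hM ⟨w.natAbs, ?_⟩
    zify
    rw [← h, ← sq, sq_abs]
  have hx' := notsq hN x hx
  have hz' := notsq hd z hz
  push_cast at hy
  have hdN : (0 : ℤ) < d * N := mul_pos hdZ hNZ
  have hk2 : k < 2 := by
    have : d * N * k < d * N * 2 := by nlinarith [sq_nonneg x]
    exact lt_of_mul_lt_mul_left this hdN.le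
  have hk1 : -1 < k := by
    have : d * N * (-1) < d * N * k := by nlinarith [sq_nonneg y, sq_nonneg z]
    exact lt_of_mul_lt_mul_left this hdN.le
  obtain rfl | rfl : k = 0 ∨ k = 1 := by omega
  · refine ⟨x, y, z, ?_, by linarith⟩
    rintro rfl
    have hy0 : y = 0 := by
      have : y ^ 2 = 0 := by nlinarith [sq_nonneg y, sq_nonneg z]
      exact pow_eq_zero_iff two_ne_zero |>.1 this
    subst hy0
    have hz0 : z = 0 := by
      have : (N : ℤ) * z ^ 2 = 0 := by linarith
      simpa [hN0.ne'] using this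
    exact hne' ⟨rfl, rfl, hz0⟩
  -- Here `d (x² + N) = y² + N z²`; multiply by `x² + N` and use multiplicativity of the form `X² +
  -- N Y²`.
  · refine ⟨x ^ 2 + N, x * y + N * z, y - x * z, by positivity, ?_⟩
    linear_combination (-(x ^ 2 + N)) * hk

/-! ### Existence for three squares: Dirichlet and reciprocity -/

/-- Dirichlet's theorem with prescribed residues modulo `8` and an odd `m`. -/
theorem exists_prime_gt_mod_eight_and_modEq {m : ℕ} (hm : Odd m) {r s : ℕ} (hr : Odd r)
    (hs : s.Coprime m) (B : ℕ) :
    ∃ p, B < p ∧ p.Prime ∧ p ≡ r [MOD 8] ∧ p ≡ s [MOD m] := by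
  have hco : Nat.Coprime 8 m := by
    have : Nat.Coprime (2 ^ 3) m := Nat.Coprime.pow_left 3 (Nat.coprime_two_left.2 hm)
    simpa using this
  have hr8 : r.Coprime 8 := by
    have : r.Coprime (2 ^ 3) := Nat.Coprime.pow_right 3 (Nat.coprime_two_right.2 hr)
    simpa using this
  obtain ⟨k, hk8, hkm⟩ := Nat.chineseRemainder hco r s
  have hk : k.Coprime (8 * m) := Nat.Coprime.mul_right
    (by rw [Nat.Coprime, hk8.gcd_eq]; exact hr8) (by rw [Nat.Coprime, hkm.gcd_eq]; exact hs)
  obtain ⟨p, hB, hp, hpk⟩ := Nat.forall_exists_prime_gt_and_modEq B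
    (q := 8 * m) (a := k) (by have := hm.pos; omega) hk
  exact ⟨p, hB, hp, (hpk.of_mul_right m).trans hk8, (hpk.of_mul_left 8).trans hkm⟩

theorem Nat.not_isSquare_of_squarefree {n : ℕ} (hn : 1 < n) (h : Squarefree n) :
    ¬ IsSquare n := by
  rintro ⟨r, rfl⟩
  have := Nat.isUnit_iff.1 (h r dvd_rfl)
  subst this
  omega

/-- `N` is a prime `p ≡ 1` mod 4, or `2p` when `d ≡ 3` mod 8. Reciprocity turns `(d/p)` into symbols
over the odd part of `d`, known because `N ≡ -1` mod `d`. -/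
theorem exists_sum_two_squares_modulus {d : ℕ} (hd : 1 < d) (hsq : Squarefree d)
    (h7 : d % 8 ≠ 7) :
    ∃ N u v : ℕ, N = u ^ 2 + v ^ 2 ∧ ¬ IsSquare N ∧ d.Coprime N ∧ d ∣ N + 1 ∧
      ∃ a : ℤ, (N : ℤ) ∣ a ^ 2 - d := by
  have coprime_of_dvd : ∀ {N : ℕ}, d ∣ N + 1 → d.Coprime N := fun h =>
    Nat.Coprime.coprime_dvd_left h (by simp)
  have lift : ∀ {p : ℕ}, p.Prime → jacobiSym d p = 1 → ∃ a : ℤ, (p : ℤ) ∣ a ^ 2 - d := by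
    intro p hp h
    have := Fact.mk hp
    obtain ⟨r, hr⟩ := ZMod.isSquare_of_jacobiSym_eq_one h
    obtain ⟨a, rfl⟩ := ZMod.intCast_surjective r
    refine ⟨a, (ZMod.intCast_zmod_eq_zero_iff_dvd _ _).1 ?_⟩
    push_cast at hr ⊢
    rw [hr]; ring
  have two : ∀ {p : ℕ}, p.Prime → p % 4 = 1 → ∃ u v : ℕ, u ^ 2 + v ^ 2 = p := by
    intro p hp h
    have := Fact.mk hp
    exact Nat.Prime.sq_add_sq (by omega)
  have hd4 : d % 4 ≠ 0 := fun h => by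
    have := Nat.isUnit_iff.1 (hsq 2 (Nat.dvd_of_mod_eq_zero h))
    omega
  have cop : ∀ m, 0 < m → (m - 1).Coprime m := fun m hm => by
    have := Nat.coprime_self_add_right (m := m - 1) (n := 1)
    rw [Nat.sub_add_cancel hm] at this
    exact this.2 (Nat.coprime_one_right _)
  have toDvd : ∀ {m p : ℕ}, 0 < m → p ≡ m - 1 [MOD m] → m ∣ p + 1 := by
    intro m p hm h
    have := h.add_right 1
    rw [Nat.sub_add_cancel hm] at this
    exact (Nat.modEq_zero_iff_dvd).1 (this.trans (by simp [Nat.ModEq]))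
  have jneg : ∀ {m p : ℕ}, m ∣ p + 1 → jacobiSym p m = jacobiSym (-1) m := by
    intro m p h
    apply jacobiSym.mod_left'
    apply Int.ModEq.symm
    rw [Int.modEq_iff_dvd]
    simpa using (Int.natCast_dvd_natCast.2 h)
  rcases Nat.even_or_odd d with he | ho
  · obtain ⟨m, rfl⟩ := he.two_dvd
    have hm : Odd m := Nat.odd_iff.2 (by omega)
    -- `r` is the class of `p` mod 8, chosen so that `(2/p)` cancels `(-1/m)`.
    obtain ⟨r, hr, hr4, hr1⟩ : ∃ r : ℕ, Odd r ∧ r % 4 = 1 ∧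
        ZMod.χ₈ (r : ZMod 8) * jacobiSym (-1) m = 1 := by
      rw [jacobiSym.at_neg_one hm]
      rcases Nat.odd_mod_four_iff.1 (Nat.odd_iff.1 hm) with h | h
      · exact ⟨1, by decide, rfl, by rw [ZMod.χ₄_nat_one_mod_four h]; decide⟩
      · exact ⟨5, by decide, rfl, by rw [ZMod.χ₄_nat_three_mod_four h]; decide⟩
    obtain ⟨p, -, hp, hp8, hpm⟩ := exists_prime_gt_mod_eight_and_modEq hm hr (cop m hm.pos) 0
    have hp4 : p % 4 = 1 := by
      rw [← hr4]; exact Nat.ModEq.of_mul_right (n := 4) 2 hp8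
    have hmp : m ∣ p + 1 := toDvd hm.pos hpm
    obtain ⟨u, v, huv⟩ := two hp hp4
    have hodd : Odd p := Nat.odd_iff.2 (by omega)
    have hdvd : 2 * m ∣ p + 1 := Nat.Coprime.mul_dvd_of_dvd_of_dvd
      (Nat.coprime_two_left.2 hm) (by omega) hmp
    refine ⟨p, u, v, huv.symm, Nat.not_isSquare_of_squarefree hp.one_lt hp.squarefree,
      coprime_of_dvd hdvd, hdvd, lift hp ?_⟩
    push_cast
    rw [jacobiSym.mul_left, jacobiSym.at_two hodd,
      ← jacobiSym.quadratic_reciprocity_one_mod_four hp4 hm, jneg hmp,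
      (ZMod.natCast_eq_natCast_iff _ _ _).2 hp8]
    exact hr1
  · rcases Nat.odd_mod_four_iff.1 (Nat.odd_iff.1 ho) with h1 | h3
    · obtain ⟨p, -, hp, hp8, hpd⟩ := exists_prime_gt_mod_eight_and_modEq ho odd_one
        (cop d ho.pos) 0
      have hp4 : p % 4 = 1 := Nat.ModEq.of_mul_right (n := 4) 2 hp8
      obtain ⟨u, v, huv⟩ := two hp hp4
      have hdvd := toDvd ho.pos hpd
      refine ⟨p, u, v, huv.symm, Nat.not_isSquare_of_squarefree hp.one_lt hp.squarefree,
        coprime_of_dvd hdvd, hdvd, lift hp ?_⟩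
      rw [← jacobiSym.quadratic_reciprocity_one_mod_four hp4 ho, jneg hdvd,
        jacobiSym.at_neg_one ho, ZMod.χ₄_nat_one_mod_four h1]
    -- A prime `p ≡ -1` mod `d` would give `(d/p) = (-1/d) = -1`. With `2p ≡ -1` instead, `(2/d) =
    -- -1` corrects the sign; this needs `d ≡ 3` mod 8.
    · obtain ⟨s, hs⟩ : ∃ s, d = 2 * s + 1 := id ho
      have hsd : s.Coprime d := by
        rw [hs]; simp
      obtain ⟨p, -, hp, hp8, hpd⟩ := exists_prime_gt_mod_eight_and_modEq ho odd_one hsd 0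
      have hp4 : p % 4 = 1 := Nat.ModEq.of_mul_right (n := 4) 2 hp8
      obtain ⟨u, v, huv⟩ := two hp hp4
      have hodd : Odd p := Nat.odd_iff.2 (by omega)
      have hdvd : d ∣ 2 * p + 1 := by
        apply toDvd ho.pos
        have := hpd.mul_left 2
        rwa [show 2 * s = d - 1 by omega] at this
      have hsf : Squarefree (2 * p) := (Nat.squarefree_mul (Nat.coprime_two_left.2 hodd)).2
        ⟨Nat.prime_two.squarefree, hp.squarefree⟩
      have hj : jacobiSym d p = 1 := by
        have h2 : jacobiSym (2 * p) d = jacobiSym (-1) d := by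
          simpa using jneg hdvd
        rw [jacobiSym.mul_left, jacobiSym.quadratic_reciprocity_one_mod_four hp4 ho,
          jacobiSym.at_two ho, jacobiSym.at_neg_one ho, ZMod.χ₄_nat_three_mod_four h3,
          ZMod.χ₈_nat_mod_eight, show d % 8 = 3 by omega,
          show ZMod.χ₈ ((3 : ℕ) : ZMod 8) = -1 by decide] at h2
        linarith
      obtain ⟨a, ha⟩ := lift hp hj
      -- Adding the odd `p` to the root if necessary makes it odd, hence a root mod `2p`.
      obtain ⟨b, hb, hb2⟩ : ∃ b : ℤ, (p : ℤ) ∣ b ^ 2 - d ∧ (2 : ℤ) ∣ b ^ 2 - d := by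
        have hpar : ∀ b : ℤ, b % 2 = 1 → (2 : ℤ) ∣ b ^ 2 - d := fun b hb => by
          have : b ^ 2 % 2 = 1 := by rw [pow_two, Int.mul_emod, hb]; rfl
          omega
        rcases Int.emod_two_eq_zero_or_one a with h | h
        · refine ⟨a + p, ?_, hpar _ (by omega)⟩
          rw [show (a + p) ^ 2 - (d : ℤ) = (a ^ 2 - d) + p * (2 * a + p) by ring]
          exact dvd_add ha (dvd_mul_right _ _)
        · exact ⟨a, ha, hpar a h⟩
      refine ⟨2 * p, u + v, ((u : ℤ) - v).natAbs, ?_, Nat.not_isSquare_of_squarefree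
        (by have := hp.one_lt; omega) hsf, coprime_of_dvd hdvd, hdvd, b, ?_⟩
      · zify
        rw [sq_abs, ← huv]
        push_cast
        ring
      · push_cast
        exact (Nat.isCoprime_iff_coprime.2 (Nat.coprime_two_left.2 hodd)).mul_dvd hb2 hb

theorem exists_sum_three_squares_eq_mul_sq {d : ℕ} (hd : 1 < d) (hsq : Squarefree d)
    (h7 : d % 8 ≠ 7) : ∃ x y z t : ℤ, t ≠ 0 ∧ x ^ 2 + y ^ 2 + z ^ 2 = d * t ^ 2 := by
  obtain ⟨N, u, v, huv, hN, hco, hdvd, a, ha⟩ := exists_sum_two_squares_modulus hd hsq h7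
  obtain ⟨t, y, z, ht, h⟩ := exists_mul_sq_eq_sq_add_mul_sq
    (Nat.not_isSquare_of_squarefree hd hsq) hN hco ha (b := 1)
    (by have := Int.natCast_dvd_natCast.2 hdvd; push_cast at this; rwa [one_pow, add_comm])
  refine ⟨y, z * u, z * v, t, ht, ?_⟩
  rw [h, huv]
  push_cast
  ring

/-- Modulo 8 the equation reads `x² + y² + z² + t² ≡ 0`, which forces all four to be even; halving
gives infinite descent. -/
theorem eq_zero_of_sum_three_squares_eq_mul_sq {d : ℤ} (hd : d % 8 = 7) {x y z t : ℤ}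
    (h : x ^ 2 + y ^ 2 + z ^ 2 = d * t ^ 2) : t = 0 := by
  induction hn : t.natAbs using Nat.strong_induction_on generalizing x y z t with
  | _ n ih =>
    by_contra ht
    have hsq : ∀ w : ℤ, (w % 2 = 0 ∧ (w ^ 2 % 8 = 0 ∨ w ^ 2 % 8 = 4)) ∨
        (w % 2 = 1 ∧ w ^ 2 % 8 = 1) := by
      intro w
      have : w % 8 = 0 ∨ w % 8 = 1 ∨ w % 8 = 2 ∨ w % 8 = 3 ∨ w % 8 = 4 ∨ w % 8 = 5 ∨
        w % 8 = 6 ∨ w % 8 = 7 := by omega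
      rw [pow_two]
      rcases this with e | e | e | e | e | e | e | e <;> simp only [Int.mul_emod w w 8, e] <;>
        omega
    have h8 : (d * t ^ 2) % 8 = 7 * (t ^ 2 % 8) % 8 := by rw [Int.mul_emod, hd]
    rw [← h] at h8
    have := hsq x
    have := hsq y
    have := hsq z
    have := hsq t
    obtain ⟨x', rfl⟩ : (2 : ℤ) ∣ x := by omega
    obtain ⟨y', rfl⟩ : (2 : ℤ) ∣ y := by omega
    obtain ⟨z', rfl⟩ : (2 : ℤ) ∣ z := by omega
    obtain ⟨t', rfl⟩ : (2 : ℤ) ∣ t := by omega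
    have := ih t'.natAbs (by omega) (x := x') (y := y') (z := z') (t := t')
      (by linarith) rfl
    omega

/-! ### Two squares -/

/-- A prime dividing the squarefree `d` has odd valuation in `d t²`, while a sum of two squares has
even valuation at primes `≡ 3` mod 4. -/
theorem Nat.exists_sq_add_sq_eq_mul_sq_iff {d : ℕ} (hsq : Squarefree d) :
    (∃ x y t : ℕ, t ≠ 0 ∧ x ^ 2 + y ^ 2 = d * t ^ 2) ↔
      ∀ p : ℕ, p.Prime → p ∣ d → p % 4 ≠ 3 := by
  constructor
  · rintro ⟨x, y, t, ht, h⟩ p hp hpd hp4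
    have := Fact.mk hp
    have hd0 : d ≠ 0 := hsq.ne_zero
    have heven := Nat.eq_sq_add_sq_iff.1 ⟨x, y, h.symm⟩ p
      (Nat.mem_primeFactors.2 ⟨hp, hpd.mul_right _, mul_ne_zero hd0 (pow_ne_zero 2 ht)⟩) hp4
    have hle := hsq.natFactorization_le_one p
    rw [Nat.factorization_def d hp] at hle
    have hge := one_le_padicValNat_of_dvd hd0 hpd
    rw [padicValNat.mul hd0 (pow_ne_zero 2 ht), padicValNat.pow] at heven
    obtain ⟨k, hk⟩ := heven
    omega
  · intro h
    obtain ⟨x, y, hxy⟩ := (Nat.eq_sq_add_sq_iff (n := d)).2 fun q hq h3 =>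
      absurd h3 (h q (Nat.prime_of_mem_primeFactors hq) (Nat.dvd_of_mem_primeFactors hq))
    exact ⟨x, y, 1, one_ne_zero, by rw [← hxy]; ring⟩

/-! ### Solution vectors and four or more squares -/

theorem exists_isPellLikeSolution {n : ℕ} {d : ℤ} (y : Fin n → ℤ) {t : ℤ} (ht : t ≠ 0)
    (h : ∑ i, y i ^ 2 = d * t ^ 2) :
    ∃ x : Fin (n + 1) → ℤ, x ≠ 0 ∧ IsPellLikeSolution n d x ∧ ∀ i, x i.castSucc = y i := by
  refine ⟨Fin.snoc y t, fun h0 => ht ?_, ?_, fun i => by simp⟩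
  · simpa using congrFun h0 (Fin.last n)
  · simpa [IsPellLikeSolution] using h

theorem IsPellLikeSolution.last_ne_zero {n : ℕ} {d : ℤ} {x : Fin (n + 1) → ℤ}
    (h : IsPellLikeSolution n d x) (hx : x ≠ 0) : x (Fin.last n) ≠ 0 := by
  intro h0
  rw [IsPellLikeSolution, h0, zero_pow two_ne_zero, mul_zero,
    Finset.sum_eq_zero_iff_of_nonneg fun _ _ => sq_nonneg _] at h
  refine hx (funext fun i => ?_)
  induction i using Fin.lastCases with
  | last => exact h0
  | cast i => simpa using h i (Finset.mem_univ i)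

theorem exists_isPellLikeSolution_of_four_le {n : ℕ} (hn : 4 ≤ n) {d : ℤ} (hd : 0 < d)
    (σ : Equiv.Perm (Fin n)) (a : Fin (n - 4) → ℤ) :
    ∃ x : Fin (n + 1) → ℤ, x ≠ 0 ∧ IsPellLikeSolution n d x ∧
      ∀ i : Fin (n - 4), x (σ (Fin.castLE (Nat.sub_le n 4) i)).castSucc = a i := by
  have hA : 0 ≤ ∑ i, a i ^ 2 := Finset.sum_nonneg fun _ _ => sq_nonneg _
  set A := ∑ i, a i ^ 2 with hAdef
  -- The choice `t = A + 1` is nonzero and makes the remainder `d t² - A` nonnegative, hence a sum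
  -- of four squares.
  obtain ⟨m, hm⟩ : ∃ m : ℕ, (m : ℤ) = d * (A + 1) ^ 2 - A :=
    ⟨(d * (A + 1) ^ 2 - A).toNat, Int.toNat_of_nonneg (by nlinarith)⟩
  obtain ⟨p, q, r, s, h4⟩ := Nat.sum_four_squares m
  have hn4 : n = n - 4 + 4 := by omega
  let g : Fin n → ℤ := fun j => Fin.append a ![(p : ℤ), q, r, s] (Fin.cast hn4 j)
  have hg : ∑ j, g j ^ 2 = d * (A + 1) ^ 2 := by
    rw [show ∑ j, g j ^ 2 = ∑ j, Fin.append a ![(p : ℤ), q, r, s] j ^ 2 from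
      Equiv.sum_comp (finCongr hn4) fun j => Fin.append a ![(p : ℤ), q, r, s] j ^ 2,
      Fin.sum_univ_add]
    simp only [Fin.append_left, Fin.append_right, Fin.sum_univ_four, ← hAdef]
    zify at h4
    simp
    linarith
  obtain ⟨x, hx, hsol, hxy⟩ := exists_isPellLikeSolution (d := d) (t := A + 1)
    (fun i => g (σ.symm i)) (by omega) (by rw [← hg]; exact Equiv.sum_comp σ.symm fun j => g j ^ 2)
  refine ⟨x, hx, hsol, fun i => ?_⟩
  rw [hxy, Equiv.symm_apply_apply]
  exact Fin.append_left a _ i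

theorem mainTheorem5 (d : ℤ) (hd : 1 < d) (hsq : Squarefree d) :
    ((∃ x : Fin (2 + 1) → ℤ, x ≠ 0 ∧ IsPellLikeSolution 2 d x) ↔
      ¬ ∃ p : ℕ, p.Prime ∧ (p : ℤ) ∣ d ∧ p ≡ 3 [MOD 4]) ∧
    ((∃ x : Fin (3 + 1) → ℤ, x ≠ 0 ∧ IsPellLikeSolution 3 d x) ↔ ¬ d ≡ 7 [ZMOD 8]) ∧
    (∀ n : ℕ, 4 ≤ n → ∃ x : Fin (n + 1) → ℤ, x ≠ 0 ∧ IsPellLikeSolution n d x) ∧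
    (∀ n : ℕ, 5 ≤ n → ∀ (σ : Equiv.Perm (Fin n)) (a : Fin (n - 4) → ℤ),
      ∃ x : Fin (n + 1) → ℤ, x ≠ 0 ∧ IsPellLikeSolution n d x ∧
        ∀ i : Fin (n - 4), x (σ (Fin.castLE (Nat.sub_le n 4) i)).castSucc = a i) := by
  have hd0 : 0 < d := by omega
  refine ⟨?_, ?_, fun n hn => ?_, fun n hn σ a =>
    exists_isPellLikeSolution_of_four_le (by omega) hd0 σ a⟩
  · lift d to ℕ using hd0.le
    have key := Nat.exists_sq_add_sq_eq_mul_sq_iff (Int.squarefree_natCast.1 hsq)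
    constructor
    · rintro ⟨x, hx, hsol⟩ ⟨p, hp, hpd, hp4⟩
      refine key.1 ⟨(x 0).natAbs, (x 1).natAbs, (x (Fin.last 2)).natAbs,
        Int.natAbs_ne_zero.2 (hsol.last_ne_zero hx), ?_⟩ p hp (Int.natCast_dvd_natCast.1 hpd) hp4
      zify
      simpa [IsPellLikeSolution, Fin.sum_univ_two] using hsol
    · intro h
      obtain ⟨x, y, t, ht, hxy⟩ := key.2 fun p hp hpd hp4 =>
        h ⟨p, hp, Int.natCast_dvd_natCast.2 hpd, hp4⟩
      obtain ⟨w, hw, hsol, -⟩ := exists_isPellLikeSolution (n := 2) (d := d) ![(x : ℤ), y]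
        (t := t) (by exact_mod_cast ht) (by simp [Fin.sum_univ_two]; exact_mod_cast hxy)
      exact ⟨w, hw, hsol⟩
  · constructor
    · rintro ⟨x, hx, hsol⟩ h7
      refine hsol.last_ne_zero hx (eq_zero_of_sum_three_squares_eq_mul_sq (d := d) h7
        (x := x 0) (y := x 1) (z := x 2) ?_)
      simpa [IsPellLikeSolution, Fin.sum_univ_three] using hsol
    · intro h7
      lift d to ℕ using hd0.le
      obtain ⟨x, y, z, t, ht, h⟩ := exists_sum_three_squares_eq_mul_sq (d := d)
        (by exact_mod_cast hd) (Int.squarefree_natCast.1 hsq)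
        (fun h => h7 (by rw [Int.ModEq]; omega))
      obtain ⟨w, hw, hsol, -⟩ := exists_isPellLikeSolution (n := 3) (d := d) ![x, y, z] ht
        (by simpa [Fin.sum_univ_three] using h)
      exact ⟨w, hw, hsol⟩
  · obtain ⟨x, hx, hsol, -⟩ := exists_isPellLikeSolution_of_four_le hn hd0 1 0
    exact ⟨x, hx, hsol⟩
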